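/- Fix $n\in\mathbb N$. **Definitions.** An $\infty$-graph is a globular set $G$: sets $G(m)$, $m\ge 0$, with maps $s,t:G(m+1)\to G(m)$ satisfying $ss=st$ and $tt=ts$; write $s^m_p,t^m_p:G(m)\to G(p)$ for the iterated sources and targets. An $\infty$-magma is an $\infty$-graph with reflexors $1^{m}_{m+1}:G(m)\to G(m+1)$, where $s(1^m_{m+1}x)=t(1^m_{m+1}x)=x$ (and $1^p_m$ denotes the composite $1^{m-1}_m\circ\cdots\circ 1^p_{p+1}$, $p<m$), and compositions $y\circ^m_p x\in G(m)$, defined for $0\le p<m$ and $x,y\in G(m)$ with $s^m_p(y)=t^m_p(x)$, subject only to the positional axioms: $s^m_q(y\circ^m_p x)=s^m_q(y)\circ^q_p s^m_q(x)$ and $t^m_q(y\circ^m_p x)=t^m_q(y)\circ^q_p t^m_q(x)$ for $p<q<m$, and $s^m_q(y\circ^m_p x)=s^m_q(x)$, $t^m_q(y\circ^m_p x)=t^m_q(y)$ for $q\le p$. An $(\infty,n)$-magma is an $\infty$-magma with reversors $j^m_p:G(m)\to G(m)$ for $n\le p<m$, such that $s\,j^{m+1}_p=j^m_p\,s$ and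 $t\,j^{m+1}_p=j^m_p\,t$ for $p<m$, while $s\,j^{p+1}_p=t$ and $t\,j^{p+1}_p=s$. Morphisms preserve all the structure. A strict $(\infty,n)$-category is a strict $\infty$-category in which every $m$-cell has a (necessarily unique) $\circ^m_p$-inverse for all $n\le p<m$; with $j^m_p$ given by these inverses it is an $(\infty,n)$-magma. An $(\infty,n)$-categorical stretching $(M,C,\pi,[-,-])$ consists of an $(\infty,n)$-magma $M$, a strict $(\infty,n)$-category $C$, a morphism $\pi:M\to C$ of $(\infty,n)$-magmas and, for all $m\ge 0$ and all parallel $c_1,c_0\in M(m)$ with $\pi(c_1)=\pi(c_0)$, a cell $[c_1,c_0]_m\in M(m+1)$ with target $c_1$ and source $c_0$, such that $\pi([c_1,c_0]_m)=1^m_{m+1}(\pi(c_1))$ and $[c,c]_m=1^m_{m+1}(c)$. (Two $m$-cells are parallel if $m=0$, or if $m\ge1$ and they have the same source and the same target.) Morphisms are commutative squares of morphisms of $(\infty,n)$-magmas that preserve the brackets. The forgetful functor $(M,C,\pi,[-,-])\mapsto M$ to $\infty$-graphs has a left adjoint; let $\mathbb T^n=(T^n,\mu^n,\lambda^n)$ be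 the monad on $\infty$-graphs generated by this adjunction. A weak $(\infty,n)$-category is a $\mathbb T^n$-algebra $(G,v)$. The $\infty$-graph $T^n(G)$ underlies the $(\infty,n)$-magma $M^n(G)$ of the free stretching on $G$; write $\star^m_p$, $1^p_m$, $j^m_p$ for its compositions, reflexors and reversors. **Theorem.** 1. For every $\mathbb T^n$-algebra $(G,v)$, the operations $$a\circ^m_p b:=v_m\bigl(\lambda^n_G(a)\star^m_p\lambda^n_G(b)\bigr)\quad(0\le p<m,\ a,b\in G(m),\ s^m_p(a)=t^m_p(b)),$$ $$\iota^p_m(a):=v_m\bigl(1^p_m(\lambda^n_G(a))\bigr)\quad(0\le p<m,\ a\in G(p)),$$ $$i^m_p(a):=v_m\bigl(j^m_p(\lambda^n_G(a))\bigr)\quad(n\le p<m,\ a\in G(m))$$ are the compositions, reflexors and reversors of an $(\infty,n)$-magma structure on $G$. 2. For this structure, $v:T^n(G)\to G$ is a morphism of $(\infty,n)$-magmas from $M^n(G)$ to $G$: $v_m(a\star^m_p b)=v_m(a)\circ^m_p v_m(b)$ for composable $a,b\in T^n(G)(m)$, $v_m(1^p_m(t))=\iota^p_m(v_p(t))$ for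 $0\le p<m$ and $t\in T^n(G)(p)$, and $v_m(j^m_p(t))=i^m_p(v_m(t))$ for $n\le p<m$ and $t\in T^n(G)(m)$. 3. For every $\infty$-graph $G$, the structure that (1) gives on $T^n(G)$ for the free algebra $(T^n(G),\mu^n_G)$ is the $(\infty,n)$-magma structure of $M^n(G)$. 4. Every morphism $f:(G,v)\to(G',v')$ of $\mathbb T^n$-algebras preserves the reflexors and the reversors: $f(\iota^p_m(t))=\iota^p_m(f(t))$ for $0\le p<m$, $t\in G(p)$, and $f(i^m_p(t))=i^m_p(f(t))$ for $n\le p<m$, $t\in G(m)$. -/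

import Mathlib

open CategoryTheory

universe u

namespace WeakCat

/-! ## Graphs -/

/-- An `∞`-graph (globular set): sets of `m`-cells with sources and targets
`s, t : X (m+1) → X m` subject to the globular identities. -/
structure InfGraph : Type (u + 1) where
  cells : ℕ → Type u
  s : ∀ {m : ℕ}, cells (m + 1) → cells m
  t : ∀ {m : ℕ}, cells (m + 1) → cells m
  s_s : ∀ {m : ℕ} (x : cells (m + 2)), s (s x) = s (t x)
  t_t : ∀ {m : ℕ} (x : cells (m + 2)), t (t x) = t (s x)

/-- Morphisms of `∞`-graphs. -/
@[ext]
structure InfGraph.Hom (X Y : InfGraph.{u}) : Type u where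
  app : ∀ m : ℕ, X.cells m → Y.cells m
  map_s : ∀ {m : ℕ} (x : X.cells (m + 1)), app m (X.s x) = Y.s (app (m + 1) x)
  map_t : ∀ {m : ℕ} (x : X.cells (m + 1)), app m (X.t x) = Y.t (app (m + 1) x)

/-- The category of `∞`-graphs. -/
instance : Category InfGraph.{u} where
  Hom := InfGraph.Hom
  id X := ⟨fun _ x => x, fun _ => rfl, fun _ => rfl⟩
  comp f g := ⟨fun m x => g.app m (f.app m x), fun x => by rw [f.map_s, g.map_s],
    fun x => by rw [f.map_t, g.map_t]⟩

namespace InfGraph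

variable {X Y : InfGraph.{u}}

/-- The iterated source `s^m_p : X m → X p`, for `p ≤ m` (the identity if `p = m`). -/
def src (X : InfGraph.{u}) {p m : ℕ} (h : p ≤ m) : X.cells m → X.cells p :=
  Nat.leRec (motive := fun m _ => X.cells m → X.cells p) id (fun _ _ f x => f (X.s x)) h

/-- The iterated target `t^m_p : X m → X p`, for `p ≤ m` (the identity if `p = m`). -/
def tgt (X : InfGraph.{u}) {p m : ℕ} (h : p ≤ m) : X.cells m → X.cells p :=
  Nat.leRec (motive := fun m _ => X.cells m → X.cells p) id (fun _ _ f x => f (X.t x)) h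

theorem src_self {m : ℕ} (x : X.cells m) : X.src le_rfl x = x := by
  simp [src]

theorem tgt_self {m : ℕ} (x : X.cells m) : X.tgt le_rfl x = x := by
  simp [tgt]

theorem src_succ {p m : ℕ} (h : p ≤ m) (h' : p ≤ m + 1) (x : X.cells (m + 1)) :
    X.src h' x = X.src h (X.s x) := by
  simp only [src]
  rw [Nat.leRec_succ _ _ h]

theorem tgt_succ {p m : ℕ} (h : p ≤ m) (h' : p ≤ m + 1) (x : X.cells (m + 1)) :
    X.tgt h' x = X.tgt h (X.t x) := by
  simp only [tgt]
  rw [Nat.leRec_succ _ _ h]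

theorem Hom.map_src (f : X ⟶ Y) {p m : ℕ} (h : p ≤ m) (x : X.cells m) :
    f.app p (X.src h x) = Y.src h (f.app m x) := by
  induction m, h using Nat.le_induction with
  | base => rw [src_self, src_self]
  | succ m h ih => rw [src_succ h, src_succ h, ih, f.map_s]

theorem Hom.map_tgt (f : X ⟶ Y) {p m : ℕ} (h : p ≤ m) (x : X.cells m) :
    f.app p (X.tgt h x) = Y.tgt h (f.app m x) := by
  induction m, h using Nat.le_induction with
  | base => rw [tgt_self, tgt_self]
  | succ m h ih => rw [tgt_succ h, tgt_succ h, ih, f.map_t]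

/-- `(y, x)` belongs to the domain of `∘^m_p`, that is, `s^m_p y = t^m_p x`. -/
def Composable (X : InfGraph.{u}) {p m : ℕ} (h : p < m) (y x : X.cells m) : Prop :=
  X.src h.le y = X.tgt h.le x

theorem Composable.map (f : X ⟶ Y) {p m : ℕ} {h : p < m} {y x : X.cells m}
    (e : X.Composable h y x) : Y.Composable h (f.app m y) (f.app m x) := by
  unfold Composable at *
  rw [← f.map_src, e, f.map_tgt]

/-- Two `m`-cells with `m ≥ 1` are parallel if they have the same source and the same target;
any two `0`-cells are parallel. -/
def Parallel (X : InfGraph.{u}) : ∀ {m : ℕ}, X.cells m → X.cells m → Prop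
  | 0, _, _ => True
  | _ + 1, x, y => X.t x = X.t y ∧ X.s x = X.s y

theorem Parallel.map (f : X ⟶ Y) : ∀ {m : ℕ} {x y : X.cells m},
    X.Parallel x y → Y.Parallel (f.app m x) (f.app m y)
  | 0, _, _, _ => trivial
  | m + 1, x, y, h => by
    refine ⟨?_, ?_⟩
    · rw [← f.map_t, h.1, f.map_t]
    · rw [← f.map_s, h.2, f.map_s]

end InfGraph

/-! ## Magmas -/

/-- The structure of an `∞`-magma on an `∞`-graph: reflexors, and compositions subject only to the
positional axioms. In the positional axioms the composability `e'` of the faces is a consequence of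
the other data. -/
@[ext]
structure InfMagmaStr (X : InfGraph.{u}) : Type u where
  /-- the reflexor `1^m_{m+1}` -/
  refl : ∀ {m : ℕ}, X.cells m → X.cells (m + 1)
  s_refl : ∀ {m : ℕ} (x : X.cells m), X.s (refl x) = x
  t_refl : ∀ {m : ℕ} (x : X.cells m), X.t (refl x) = x
  /-- the composite `y ∘^m_p x` -/
  comp : ∀ {p m : ℕ} (h : p < m) (y x : X.cells m), X.Composable h y x → X.cells m
  src_comp : ∀ {p q m : ℕ} (hp : p < q) (hq : q < m) (y x : X.cells m)
    (e : X.Composable (hp.trans hq) y x)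
    (e' : X.Composable hp (X.src hq.le y) (X.src hq.le x)),
    X.src hq.le (comp (hp.trans hq) y x e) = comp hp (X.src hq.le y) (X.src hq.le x) e'
  tgt_comp : ∀ {p q m : ℕ} (hp : p < q) (hq : q < m) (y x : X.cells m)
    (e : X.Composable (hp.trans hq) y x)
    (e' : X.Composable hp (X.tgt hq.le y) (X.tgt hq.le x)),
    X.tgt hq.le (comp (hp.trans hq) y x e) = comp hp (X.tgt hq.le y) (X.tgt hq.le x) e'
  src_comp_of_le : ∀ {p q m : ℕ} (hq : q ≤ p) (h : p < m) (y x : X.cells m)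
    (e : X.Composable h y x), X.src (hq.trans h.le) (comp h y x e) = X.src (hq.trans h.le) x
  tgt_comp_of_le : ∀ {p q m : ℕ} (hq : q ≤ p) (h : p < m) (y x : X.cells m)
    (e : X.Composable h y x), X.tgt (hq.trans h.le) (comp h y x e) = X.tgt (hq.trans h.le) y

/-- The structure of an `(∞,n)`-graph on an `∞`-graph: reversors `j^m_p` for `n ≤ p < m`. -/
@[ext]
structure RevStr (n : ℕ) (X : InfGraph.{u}) : Type u where
  rev : ∀ {p m : ℕ}, n ≤ p → p < m → X.cells m → X.cells m
  s_rev : ∀ {p m : ℕ} (hn : n ≤ p) (h : p < m) (h' : p < m + 1) (x : X.cells (m + 1)),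
    X.s (rev hn h' x) = rev hn h (X.s x)
  t_rev : ∀ {p m : ℕ} (hn : n ≤ p) (h : p < m) (h' : p < m + 1) (x : X.cells (m + 1)),
    X.t (rev hn h' x) = rev hn h (X.t x)
  s_rev_self : ∀ {p : ℕ} (hn : n ≤ p) (x : X.cells (p + 1)),
    X.s (rev hn p.lt_succ_self x) = X.t x
  t_rev_self : ∀ {p : ℕ} (hn : n ≤ p) (x : X.cells (p + 1)),
    X.t (rev hn p.lt_succ_self x) = X.s x

/-- The structure of an `(∞,n)`-magma on an `∞`-graph. -/
@[ext]
structure MagmaStr (n : ℕ) (X : InfGraph.{u}) : Type u extends InfMagmaStr X, RevStr n X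

variable {n : ℕ} {X Y Z : InfGraph.{u}}

namespace InfMagmaStr

/-- The reflexor `1^p_m = 1^{m-1}_m ∘ ⋯ ∘ 1^p_{p+1} : X p → X m`. -/
def reflTo (S : InfMagmaStr X) {p m : ℕ} (h : p ≤ m) (x : X.cells p) : X.cells m :=
  Nat.leRecOn h (fun {_} => S.refl) x

theorem reflTo_self (S : InfMagmaStr X) {m : ℕ} (x : X.cells m) : S.reflTo le_rfl x = x :=
  Nat.leRecOn_self x

theorem reflTo_succ (S : InfMagmaStr X) {p m : ℕ} (h : p ≤ m) (h' : p ≤ m + 1)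
    (x : X.cells p) : S.reflTo h' x = S.refl (S.reflTo h x) :=
  Nat.leRecOn_succ h x

theorem reflTo_one (S : InfMagmaStr X) {m : ℕ} (h : m ≤ m + 1) (x : X.cells m) :
    S.reflTo h x = S.refl x :=
  Nat.leRecOn_succ' x

/-- The axioms making an `∞`-magma a strict `∞`-category. All the composability hypotheses of an
axiom follow from those that are needed to write down its left-hand side. -/
structure IsStrict (S : InfMagmaStr X) : Prop where
  assoc : ∀ {p m : ℕ} (h : p < m) (z y x : X.cells m) (ezy : X.Composable h z y)
    (eyx : X.Composable h y x) (e₁ : X.Composable h (S.comp h z y ezy) x)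
    (e₂ : X.Composable h z (S.comp h y x eyx)),
    S.comp h (S.comp h z y ezy) x e₁ = S.comp h z (S.comp h y x eyx) e₂
  comp_unit : ∀ {p m : ℕ} (h : p < m) (x : X.cells m)
    (e : X.Composable h x (S.reflTo h.le (X.src h.le x))),
    S.comp h x (S.reflTo h.le (X.src h.le x)) e = x
  unit_comp : ∀ {p m : ℕ} (h : p < m) (x : X.cells m)
    (e : X.Composable h (S.reflTo h.le (X.tgt h.le x)) x),
    S.comp h (S.reflTo h.le (X.tgt h.le x)) x e = x
  interchange : ∀ {q p m : ℕ} (hq : q < p) (hp : p < m) (y x y' x' : X.cells m)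
    (e₁ : X.Composable hp y x) (e₂ : X.Composable hp y' x')
    (e₃ : X.Composable (hq.trans hp) y y') (e₄ : X.Composable (hq.trans hp) x x')
    (e₅ : X.Composable (hq.trans hp) (S.comp hp y x e₁) (S.comp hp y' x' e₂))
    (e₆ : X.Composable hp (S.comp (hq.trans hp) y y' e₃) (S.comp (hq.trans hp) x x' e₄)),
    S.comp (hq.trans hp) (S.comp hp y x e₁) (S.comp hp y' x' e₂) e₅ =
      S.comp hp (S.comp (hq.trans hp) y y' e₃) (S.comp (hq.trans hp) x x' e₄) e₆
  refl_comp : ∀ {q p m : ℕ} (hq : q < p) (hp : p < m) (y x : X.cells p)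
    (e : X.Composable hq y x)
    (e' : X.Composable (hq.trans hp) (S.reflTo hp.le y) (S.reflTo hp.le x)),
    S.reflTo hp.le (S.comp hq y x e) =
      S.comp (hq.trans hp) (S.reflTo hp.le y) (S.reflTo hp.le x) e'

end InfMagmaStr

/-- An `(∞,n)`-magma is a strict `(∞,n)`-category if its `∞`-magma is a strict `∞`-category and
`j^m_p x` is a `∘^m_p`-inverse of `x`, for `n ≤ p < m` and every `m`-cell `x`. (Such inverses are
unique, so the reversors are determined by the strict `∞`-category.) -/
structure MagmaStr.IsStrict (S : MagmaStr n X) : Prop where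
  strict : S.toInfMagmaStr.IsStrict
  comp_rev : ∀ {p m : ℕ} (hn : n ≤ p) (h : p < m) (x : X.cells m)
    (e : X.Composable h x (S.rev hn h x)),
    S.comp h x (S.rev hn h x) e = S.reflTo h.le (X.tgt h.le x)
  rev_comp : ∀ {p m : ℕ} (hn : n ≤ p) (h : p < m) (x : X.cells m)
    (e : X.Composable h (S.rev hn h x) x),
    S.comp h (S.rev hn h x) x e = S.reflTo h.le (X.src h.le x)

/-- `f` preserves the reflexors `1^p_m`, `p < m`. -/
def PreservesReflexors (S : MagmaStr n X) (S' : MagmaStr n Y) (f : X ⟶ Y) : Prop :=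
  ∀ {p m : ℕ} (h : p < m) (x : X.cells p),
    f.app m (S.reflTo h.le x) = S'.reflTo h.le (f.app p x)

/-- `f` preserves the compositions `∘^m_p`, `p < m`. -/
def PreservesCompositions (S : MagmaStr n X) (S' : MagmaStr n Y) (f : X ⟶ Y) : Prop :=
  ∀ {p m : ℕ} (h : p < m) (y x : X.cells m) (e : X.Composable h y x),
    f.app m (S.comp h y x e) = S'.comp h (f.app m y) (f.app m x) (e.map f)

/-- `f` preserves the reversors `j^m_p`, `n ≤ p < m`. -/
def PreservesReversors (S : MagmaStr n X) (S' : MagmaStr n Y) (f : X ⟶ Y) : Prop :=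
  ∀ {p m : ℕ} (hn : n ≤ p) (h : p < m) (x : X.cells m),
    f.app m (S.rev hn h x) = S'.rev hn h (f.app m x)

/-- `f` is a morphism of `(∞,n)`-magmas. -/
structure IsMagmaHom (S : MagmaStr n X) (S' : MagmaStr n Y) (f : X ⟶ Y) : Prop where
  map_refl : PreservesReflexors S S' f
  map_comp : PreservesCompositions S S' f
  map_rev : PreservesReversors S S' f

theorem preservesReflexors_iff {S : MagmaStr n X} {S' : MagmaStr n Y} {f : X ⟶ Y} :
    PreservesReflexors S S' f ↔
      ∀ {m : ℕ} (x : X.cells m), f.app (m + 1) (S.refl x) = S'.refl (f.app m x) := by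
  refine ⟨fun H m x => ?_, fun H p m h x => ?_⟩
  · have := H m.lt_succ_self x
    rwa [S.reflTo_one, S'.reflTo_one] at this
  · induction m, h using Nat.le_induction with
    | base => rw [S.reflTo_one, S'.reflTo_one, H]
    | succ m h ih =>
      have h' : p ≤ m := Nat.le_of_succ_le h
      rw [S.reflTo_succ h', S'.reflTo_succ h', H]
      exact congrArg _ ih

theorem IsMagmaHom.map_reflTo {S : MagmaStr n X} {S' : MagmaStr n Y} {f : X ⟶ Y}
    (H : IsMagmaHom S S' f) {p m : ℕ} (h : p < m) (x : X.cells p) :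
    f.app m (S.reflTo h.le x) = S'.reflTo h.le (f.app p x) := H.map_refl h x

theorem IsMagmaHom.id (S : MagmaStr n X) : IsMagmaHom S S (𝟙 X) where
  map_refl _ _ := rfl
  map_comp _ _ _ _ := rfl
  map_rev _ _ _ := rfl

theorem IsMagmaHom.comp {S : MagmaStr n X} {S' : MagmaStr n Y} {S'' : MagmaStr n Z}
    {f : X ⟶ Y} {g : Y ⟶ Z} (hf : IsMagmaHom S S' f) (hg : IsMagmaHom S' S'' g) :
    IsMagmaHom S S'' (f ≫ g) where
  map_refl h x := (congrArg (g.app _) (hf.map_refl h x)).trans (hg.map_refl h _)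
  map_comp h y x e := (congrArg (g.app _) (hf.map_comp h y x e)).trans (hg.map_comp h _ _ _)
  map_rev hn h x := (congrArg (g.app _) (hf.map_rev hn h x)).trans (hg.map_rev hn h _)

/-! ## Stretchings -/

/-- An `(∞,n)`-categorical stretching: a morphism `π : M → C` of `(∞,n)`-magmas to a strict
`(∞,n)`-category, with a bracketing `[c₁, c₀]_m : c₀ → c₁` for all parallel `m`-cells of `M` that
have the same image under `π`. -/
structure Stretching (n : ℕ) : Type (u + 1) where
  M : InfGraph.{u}
  mag : MagmaStr n M
  C : InfGraph.{u}
  cmag : MagmaStr n C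
  strict : cmag.IsStrict
  π : M ⟶ C
  π_hom : IsMagmaHom mag cmag π
  bracket : ∀ {m : ℕ} (c₁ c₀ : M.cells m), M.Parallel c₁ c₀ → π.app m c₁ = π.app m c₀ →
    M.cells (m + 1)
  t_bracket : ∀ {m : ℕ} (c₁ c₀ : M.cells m) (h : M.Parallel c₁ c₀)
    (hπ : π.app m c₁ = π.app m c₀), M.t (bracket c₁ c₀ h hπ) = c₁
  s_bracket : ∀ {m : ℕ} (c₁ c₀ : M.cells m) (h : M.Parallel c₁ c₀)
    (hπ : π.app m c₁ = π.app m c₀), M.s (bracket c₁ c₀ h hπ) = c₀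
  π_bracket : ∀ {m : ℕ} (c₁ c₀ : M.cells m) (h : M.Parallel c₁ c₀)
    (hπ : π.app m c₁ = π.app m c₀),
    π.app (m + 1) (bracket c₁ c₀ h hπ) = cmag.refl (π.app m c₁)
  bracket_self : ∀ {m : ℕ} (c : M.cells m) (h : M.Parallel c c)
    (hπ : π.app m c = π.app m c), bracket c c h hπ = mag.refl c

theorem π_eq_map {M M' C C' : InfGraph.{u}} {π : M ⟶ C} {π' : M' ⟶ C'} {f : M ⟶ M'}
    {c : C ⟶ C'} (comm : f ≫ π' = π ≫ c) {m : ℕ} {x y : M.cells m}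
    (h : π.app m x = π.app m y) : π'.app m (f.app m x) = π'.app m (f.app m y) := by
  have e : ∀ z : M.cells m, π'.app m (f.app m z) = c.app m (π.app m z) := fun z =>
    congrArg (fun k : M ⟶ C' => k.app m z) comm
  rw [e, e, h]

/-- Morphisms of `(∞,n)`-categorical stretchings. -/
@[ext]
structure Stretching.Hom (E E' : Stretching.{u} n) : Type u where
  m : E.M ⟶ E'.M
  c : E.C ⟶ E'.C
  m_hom : IsMagmaHom E.mag E'.mag m
  c_hom : IsMagmaHom E.cmag E'.cmag c
  comm : m ≫ E'.π = E.π ≫ c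
  map_bracket : ∀ {k : ℕ} (c₁ c₀ : E.M.cells k) (h : E.M.Parallel c₁ c₀)
    (hπ : E.π.app k c₁ = E.π.app k c₀),
    m.app (k + 1) (E.bracket c₁ c₀ h hπ) =
      E'.bracket (m.app k c₁) (m.app k c₀) (h.map m) (π_eq_map comm hπ)

/-- The category of `(∞,n)`-categorical stretchings. -/
instance : Category (Stretching.{u} n) where
  Hom := Stretching.Hom
  id E := ⟨𝟙 _, 𝟙 _, .id _, .id _, rfl, fun _ _ _ _ => rfl⟩
  comp {E E' E''} f g :=
    { m := f.m ≫ g.m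
      c := f.c ≫ g.c
      m_hom := f.m_hom.comp g.m_hom
      c_hom := f.c_hom.comp g.c_hom
      comm := by rw [Category.assoc, g.comm, ← Category.assoc, f.comm, Category.assoc]
      map_bracket := fun c₁ c₀ h hπ =>
        (congrArg (g.m.app _) (f.map_bracket c₁ c₀ h hπ)).trans (g.map_bracket _ _ _ _) }

/-- The forgetful functor `(M, C, π, [-,-]) ↦ M` from stretchings to `∞`-graphs. -/
def stretchForget (n : ℕ) : Stretching.{u} n ⥤ InfGraph.{u} where
  obj E := E.M
  map f := f.m

/-! ## Free stretchings

The rest of the section proves that the forgetful functor has a left adjoint. The free stretching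
on `G` is built from formal terms: those that can be evaluated in all stretchings under `G`, two
terms being identified if they always have the same value. -/

namespace Free

/-- The two underlying magmas of a stretching: `M` for `false` and `C` for `true`. -/
def gr (E : Stretching.{u} n) : Bool → InfGraph.{u}
  | false => E.M
  | true => E.C

def ms (E : Stretching.{u} n) : ∀ b, MagmaStr n (gr E b)
  | false => E.mag
  | true => E.cmag

/-- A stretching under the `∞`-graph `G`. -/
structure Idx (n : ℕ) (G : InfGraph.{u}) : Type (u + 1) where
  E : Stretching.{u} n
  φ : G ⟶ E.M

inductive Tm (n : ℕ) (G : InfGraph.{u}) : Bool → ℕ → Type u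
  | gen {m : ℕ} : G.cells m → Tm n G false m
  | s {b : Bool} {m : ℕ} : Tm n G b (m + 1) → Tm n G b m
  | t {b : Bool} {m : ℕ} : Tm n G b (m + 1) → Tm n G b m
  | refl {b : Bool} {m : ℕ} : Tm n G b m → Tm n G b (m + 1)
  | comp {b : Bool} {p m : ℕ} (h : p < m) : Tm n G b m → Tm n G b m → Tm n G b m
  | rev {b : Bool} {p m : ℕ} (hn : n ≤ p) (h : p < m) : Tm n G b m → Tm n G b m
  | bra {m : ℕ} : Tm n G false m → Tm n G false m → Tm n G false (m + 1)
  | proj {m : ℕ} : Tm n G false m → Tm n G true m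

variable {G : InfGraph.{u}}

open Classical in
/-- The value of a term in a stretching under `G` (meaningless unless the term is well formed). -/
noncomputable def eval (i : Idx n G) : ∀ {b : Bool} {m : ℕ}, Tm n G b m → (gr i.E b).cells m
  | _, _, .gen g => i.φ.app _ g
  | b, _, .s x => (gr i.E b).s (eval i x)
  | b, _, .t x => (gr i.E b).t (eval i x)
  | b, _, .refl x => (ms i.E b).refl (eval i x)
  | b, _, .comp h y x =>
    if e : (gr i.E b).Composable h (eval i y) (eval i x) then
      (ms i.E b).comp h (eval i y) (eval i x) e else eval i y
  | b, _, .rev hn h x => (ms i.E b).rev hn h (eval i x)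
  | _, _, .bra c₁ c₀ =>
    if e : i.E.M.Parallel (eval i c₁) (eval i c₀) ∧
        i.E.π.app _ (eval i c₁) = i.E.π.app _ (eval i c₀) then
      i.E.bracket (eval i c₁) (eval i c₀) e.1 e.2 else i.E.mag.refl (eval i c₁)
  | _, _, .proj x => i.E.π.app _ (eval i x)

/-- A term is well formed if its operations are defined in every stretching under `G`. -/
def Wf : ∀ {b : Bool} {m : ℕ}, Tm n G b m → Prop
  | _, _, .gen _ => True
  | _, _, .s x => Wf x
  | _, _, .t x => Wf x
  | _, _, .refl x => Wf x
  | b, _, .comp h y x =>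
    Wf y ∧ Wf x ∧ ∀ i : Idx n G, (gr i.E b).Composable h (eval i y) (eval i x)
  | _, _, .rev _ _ x => Wf x
  | _, _, .bra c₁ c₀ => Wf c₁ ∧ Wf c₀ ∧ ∀ i : Idx n G,
    i.E.M.Parallel (eval i c₁) (eval i c₀) ∧
      i.E.π.app _ (eval i c₁) = i.E.π.app _ (eval i c₀)
  | _, _, .proj x => Wf x

/-- A compatible family of cells is definable if it is the value of a well formed term. -/
def Dfn {b : Bool} {m : ℕ} (a : ∀ i : Idx n G, (gr i.E b).cells m) : Prop :=
  ∃ x : Tm n G b m, Wf x ∧ ∀ i, eval i x = a i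

variable (n G) in
abbrev Fam (b : Bool) (m : ℕ) : Type (u + 1) :=
  {a : ∀ i : Idx n G, (gr i.E b).cells m // Dfn a}

instance (b : Bool) (m : ℕ) : Small.{u} (Fam n G b m) := by
  refine small_of_surjective (α := {x : Tm n G b m // Wf x})
    (f := fun x => ⟨fun i => eval i x.1, x.1, x.2, fun _ => rfl⟩) ?_
  rintro ⟨a, x, hx, h⟩
  exact ⟨⟨x, hx⟩, Subtype.ext (funext h)⟩

variable (n G) in
def Cell (b : Bool) (m : ℕ) : Type u := Shrink.{u} (Fam n G b m)

noncomputable def ev {b : Bool} {m : ℕ} (x : Cell n G b m) (i : Idx n G) :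
    (gr i.E b).cells m :=
  ((equivShrink _).symm x).1 i

theorem ev_dfn {b : Bool} {m : ℕ} (x : Cell n G b m) : Dfn (ev x) :=
  ((equivShrink _).symm x).2

noncomputable def mk {b : Bool} {m : ℕ} (a : ∀ i : Idx n G, (gr i.E b).cells m) (h : Dfn a) :
    Cell n G b m :=
  equivShrink _ ⟨a, h⟩

@[simp]
theorem ev_mk {b : Bool} {m : ℕ} (a : ∀ i : Idx n G, (gr i.E b).cells m) (h : Dfn a)
    (i : Idx n G) : ev (mk a h) i = a i := by
  simp [ev, mk]

theorem ev_ext {b : Bool} {m : ℕ} {x y : Cell n G b m} (h : ∀ i, ev x i = ev y i) : x = y :=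
  (equivShrink _).symm.injective (Subtype.ext (funext h))

variable (n G) in
/-- The underlying `∞`-graphs of the free stretching. -/
noncomputable def graph (b : Bool) : InfGraph.{u} where
  cells := Cell n G b
  s x := mk (fun i => (gr i.E b).s (ev x i)) (by
    obtain ⟨z, hz, e⟩ := ev_dfn x
    exact ⟨.s z, hz, fun i => by simp [eval, e]⟩)
  t x := mk (fun i => (gr i.E b).t (ev x i)) (by
    obtain ⟨z, hz, e⟩ := ev_dfn x
    exact ⟨.t z, hz, fun i => by simp [eval, e]⟩)
  s_s x := ev_ext fun i => by simp [InfGraph.s_s]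
  t_t x := ev_ext fun i => by simp [InfGraph.t_t]

/-- Evaluation as a morphism of `∞`-graphs. -/
noncomputable def evHom (i : Idx n G) (b : Bool) : graph n G b ⟶ gr i.E b where
  app _ x := ev x i
  map_s _ := ev_mk _ _ i
  map_t _ := ev_mk _ _ i

@[simp]
theorem ev_src (i : Idx n G) {b : Bool} {p m : ℕ} (h : p ≤ m) (x : (graph n G b).cells m) :
    ev ((graph n G b).src h x) i = (gr i.E b).src h (ev x i) :=
  (evHom i b).map_src h x

@[simp]
theorem ev_tgt (i : Idx n G) {b : Bool} {p m : ℕ} (h : p ≤ m) (x : (graph n G b).cells m) :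
    ev ((graph n G b).tgt h x) i = (gr i.E b).tgt h (ev x i) :=
  (evHom i b).map_tgt h x

theorem ev_s (i : Idx n G) {b : Bool} {m : ℕ} (x : (graph n G b).cells (m + 1)) :
    ev ((graph n G b).s x) i = (gr i.E b).s (ev x i) :=
  ev_mk _ _ i

theorem ev_t (i : Idx n G) {b : Bool} {m : ℕ} (x : (graph n G b).cells (m + 1)) :
    ev ((graph n G b).t x) i = (gr i.E b).t (ev x i) :=
  ev_mk _ _ i

theorem composable_ev (i : Idx n G) {b : Bool} {p m : ℕ} {h : p < m}
    {y x : (graph n G b).cells m} (e : (graph n G b).Composable h y x) :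
    (gr i.E b).Composable h (ev y i) (ev x i) :=
  e.map (evHom i b)

noncomputable def fcomp {b : Bool} {p m : ℕ} (h : p < m) (y x : (graph n G b).cells m)
    (e : (graph n G b).Composable h y x) : (graph n G b).cells m :=
  mk (fun i => (ms i.E b).comp h (ev y i) (ev x i) (composable_ev i e)) (by
    obtain ⟨z, hz, ez⟩ := ev_dfn y
    obtain ⟨w, hw, ew⟩ := ev_dfn x
    have H : ∀ i : Idx n G, (gr i.E b).Composable h (eval i z) (eval i w) := fun i => by
      rw [ez, ew]; exact composable_ev i e
    refine ⟨.comp h z w, ⟨hz, hw, H⟩, fun i => ?_⟩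
    rw [eval, dif_pos (H i)]
    congr 1
    · exact ez i
    · exact ew i)

theorem ev_fcomp (i : Idx n G) {b : Bool} {p m : ℕ} (h : p < m) (y x : (graph n G b).cells m)
    (e : (graph n G b).Composable h y x) :
    ev (fcomp h y x e) i = (ms i.E b).comp h (ev y i) (ev x i) (composable_ev i e) :=
  ev_mk _ _ i

theorem comp_congr {X : InfGraph.{u}} (S : InfMagmaStr X) {p m : ℕ} (h : p < m)
    {y y' x x' : X.cells m} (hy : y = y') (hx : x = x') (e : X.Composable h y x)
    (e' : X.Composable h y' x') : S.comp h y x e = S.comp h y' x' e' := by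
  subst hy hx; rfl

variable (n G) in
/-- The `(∞,n)`-magmas of the free stretching. -/
noncomputable def magma (b : Bool) : MagmaStr n (graph n G b) where
  refl x := mk (fun i => (ms i.E b).refl (ev x i)) (by
    obtain ⟨z, hz, e⟩ := ev_dfn x
    exact ⟨.refl z, hz, fun i => by simp [eval, e]⟩)
  s_refl x := ev_ext fun i => by
    refine (ev_mk _ _ i).trans ?_
    rw [ev_mk, (ms i.E b).s_refl]
  t_refl x := ev_ext fun i => by
    refine (ev_mk _ _ i).trans ?_
    rw [ev_mk, (ms i.E b).t_refl]
  comp h y x e := fcomp h y x e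
  src_comp hp hq y x e e' := ev_ext fun i => by
    have h' := composable_ev i e'
    simp only [ev_src] at h'
    rw [ev_src, ev_fcomp, ev_fcomp, (ms i.E b).src_comp hp hq _ _ _ h']
    exact comp_congr _ _ (ev_src ..).symm (ev_src ..).symm _ _
  tgt_comp hp hq y x e e' := ev_ext fun i => by
    have h' := composable_ev i e'
    simp only [ev_tgt] at h'
    rw [ev_tgt, ev_fcomp, ev_fcomp, (ms i.E b).tgt_comp hp hq _ _ _ h']
    exact comp_congr _ _ (ev_tgt ..).symm (ev_tgt ..).symm _ _
  src_comp_of_le hq h y x e := ev_ext fun i => by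
    rw [ev_src, ev_src, ev_fcomp, (ms i.E b).src_comp_of_le hq]
  tgt_comp_of_le hq h y x e := ev_ext fun i => by
    rw [ev_tgt, ev_tgt, ev_fcomp, (ms i.E b).tgt_comp_of_le hq]
  rev hn h x := mk (fun i => (ms i.E b).rev hn h (ev x i)) (by
    obtain ⟨z, hz, e⟩ := ev_dfn x
    exact ⟨.rev hn h z, hz, fun i => by simp [eval, e]⟩)
  s_rev hn h h' x := ev_ext fun i => by
    refine (ev_mk _ _ i).trans ?_
    rw [ev_mk, ev_mk, (ms i.E b).s_rev hn h]
    exact congrArg _ (ev_s i x).symm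
  t_rev hn h h' x := ev_ext fun i => by
    refine (ev_mk _ _ i).trans ?_
    rw [ev_mk, ev_mk, (ms i.E b).t_rev hn h]
    exact congrArg _ (ev_t i x).symm
  s_rev_self hn x := ev_ext fun i => by
    refine (ev_mk _ _ i).trans ?_
    rw [ev_mk, (ms i.E b).s_rev_self hn]
    exact (ev_t i x).symm
  t_rev_self hn x := ev_ext fun i => by
    refine (ev_mk _ _ i).trans ?_
    rw [ev_mk, (ms i.E b).t_rev_self hn]
    exact (ev_s i x).symm

theorem evHom_isMagmaHom (i : Idx n G) (b : Bool) :
    IsMagmaHom (magma n G b) (ms i.E b) (evHom i b) where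
  map_refl := preservesReflexors_iff.2 fun _ => ev_mk _ _ i
  map_comp h y x e := ev_fcomp i h y x e
  map_rev _ _ _ := ev_mk _ _ i

theorem ev_comp (i : Idx n G) {b : Bool} {p m : ℕ} (h : p < m) (y x : (graph n G b).cells m)
    (e : (graph n G b).Composable h y x) :
    ev ((magma n G b).comp h y x e) i =
      (ms i.E b).comp h (ev y i) (ev x i) (composable_ev i e) :=
  ev_mk _ _ i

theorem ev_comp_of (i : Idx n G) {b : Bool} {p m : ℕ} (h : p < m)
    {y x : (graph n G b).cells m} (e : (graph n G b).Composable h y x)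
    {y' x' : (gr i.E b).cells m} (hy : ev y i = y') (hx : ev x i = x') :
    ∃ e', ev ((magma n G b).comp h y x e) i = (ms i.E b).comp h y' x' e' := by
  subst hy hx
  exact ⟨_, ev_comp i h y x e⟩

theorem ev_reflTo (i : Idx n G) {b : Bool} {p m : ℕ} (h : p < m) (x : (graph n G b).cells p) :
    ev ((magma n G b).reflTo h.le x) i = (ms i.E b).reflTo h.le (ev x i) :=
  (evHom_isMagmaHom i b).map_refl h x

theorem ev_rev (i : Idx n G) {b : Bool} {p m : ℕ} (hn : n ≤ p) (h : p < m)
    (x : (graph n G b).cells m) :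
    ev ((magma n G b).rev hn h x) i = (ms i.E b).rev hn h (ev x i) :=
  ev_mk _ _ i

theorem ev_refl (i : Idx n G) {b : Bool} {m : ℕ} (x : (graph n G b).cells m) :
    ev ((magma n G b).refl x) i = (ms i.E b).refl (ev x i) :=
  ev_mk _ _ i

variable (n G) in
theorem magma_strict : (magma n G true).IsStrict where
  strict :=
    { assoc := fun h z y x ezy eyx e₁ e₂ => ev_ext fun i => by
        obtain ⟨h₁, E₁⟩ := ev_comp_of i h e₁ (ev_comp ..) rfl
        obtain ⟨h₂, E₂⟩ := ev_comp_of i h e₂ rfl (ev_comp ..)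
        exact E₁.trans ((i.E.strict.strict.assoc ..).trans E₂.symm)
      comp_unit := fun h x e => ev_ext fun i => by
        obtain ⟨h₁, E₁⟩ := ev_comp_of i h e rfl ((ev_reflTo i h _).trans
          (congrArg _ (ev_src ..)))
        exact E₁.trans (i.E.strict.strict.comp_unit ..)
      unit_comp := fun h x e => ev_ext fun i => by
        obtain ⟨h₁, E₁⟩ := ev_comp_of i h e ((ev_reflTo i h _).trans
          (congrArg _ (ev_tgt ..))) rfl
        exact E₁.trans (i.E.strict.strict.unit_comp ..)
      interchange := fun hq hp y x y' x' e₁ e₂ e₃ e₄ e₅ e₆ => ev_ext fun i => by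
        obtain ⟨h₅, E₅⟩ := ev_comp_of i _ e₅ (ev_comp ..) (ev_comp ..)
        obtain ⟨h₆, E₆⟩ := ev_comp_of i _ e₆ (ev_comp ..) (ev_comp ..)
        exact E₅.trans ((i.E.strict.strict.interchange hq hp ..).trans E₆.symm)
      refl_comp := fun hq hp y x e e' => ev_ext fun i => by
        obtain ⟨h', E'⟩ := ev_comp_of i _ e' (ev_reflTo i hp _) (ev_reflTo i hp _)
        exact ((ev_reflTo i hp _).trans (congrArg _ (ev_comp ..))).trans
          ((i.E.strict.strict.refl_comp hq hp ..).trans E'.symm) }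
  comp_rev hn h x e := ev_ext fun i => by
    obtain ⟨h', E'⟩ := ev_comp_of i _ e rfl (ev_rev ..)
    exact E'.trans ((i.E.strict.comp_rev hn h ..).trans
      ((ev_reflTo i h _).trans (congrArg _ (ev_tgt i h.le x))).symm)
  rev_comp hn h x e := ev_ext fun i => by
    obtain ⟨h', E'⟩ := ev_comp_of i _ e (ev_rev ..) rfl
    exact E'.trans ((i.E.strict.rev_comp hn h ..).trans
      ((ev_reflTo i h _).trans (congrArg _ (ev_src i h.le x))).symm)

noncomputable def fproj {m : ℕ} (x : (graph n G false).cells m) : (graph n G true).cells m :=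
  mk (b := true) (fun i => i.E.π.app m (ev x i)) (by
    obtain ⟨z, hz, e⟩ := ev_dfn x
    exact ⟨.proj z, hz, fun i => congrArg (i.E.π.app m) (e i)⟩)

theorem ev_fproj (i : Idx n G) {m : ℕ} (x : (graph n G false).cells m) :
    ev (fproj x) i = i.E.π.app m (ev x i) :=
  ev_mk (b := true) _ _ i

variable (n G) in
noncomputable def proj : graph n G false ⟶ graph n G true where
  app _ := fproj
  map_s x := ev_ext fun i => (ev_fproj i _).trans <| (congrArg (i.E.π.app _) (ev_s i x)).trans <|
    (i.E.π.map_s _).trans <| (congrArg i.E.C.s (ev_fproj i x)).symm.trans (ev_s i (fproj x)).symm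
  map_t x := ev_ext fun i => (ev_fproj i _).trans <| (congrArg (i.E.π.app _) (ev_t i x)).trans <|
    (i.E.π.map_t _).trans <| (congrArg i.E.C.t (ev_fproj i x)).symm.trans (ev_t i (fproj x)).symm

theorem ev_proj (i : Idx n G) {m : ℕ} (x : (graph n G false).cells m) :
    ev ((proj n G).app m x) i = i.E.π.app m (ev x i) :=
  ev_fproj i x

theorem proj_isMagmaHom : IsMagmaHom (magma n G false) (magma n G true) (proj n G) where
  map_refl := preservesReflexors_iff.2 fun x => ev_ext fun i => by
    rw [ev_proj, ev_refl, ev_refl, ev_proj]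
    exact preservesReflexors_iff.1 i.E.π_hom.map_refl _
  map_comp h y x e := ev_ext fun i => by
    have h' := composable_ev i (e.map (proj n G))
    rw [ev_proj, ev_proj] at h'
    rw [ev_proj, ev_comp, ev_comp, comp_congr _ _ (ev_proj ..) (ev_proj ..) _ h']
    exact i.E.π_hom.map_comp ..
  map_rev hn h x := ev_ext fun i => by
    rw [ev_proj, ev_rev, ev_rev, ev_proj]
    exact i.E.π_hom.map_rev ..

theorem proj_ev (i : Idx n G) {m : ℕ} {x y : (graph n G false).cells m}
    (h : (proj n G).app m x = (proj n G).app m y) :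
    i.E.π.app m (ev x i) = i.E.π.app m (ev y i) := by
  rw [← ev_proj, ← ev_proj, h]

theorem parallel_ev (i : Idx n G) {m : ℕ} {x y : (graph n G false).cells m}
    (h : (graph n G false).Parallel x y) : i.E.M.Parallel (ev x i) (ev y i) :=
  h.map (evHom i false)

theorem bracket_congr (E : Stretching.{u} n) {m : ℕ} {a a' c c' : E.M.cells m} (ha : a = a')
    (hc : c = c') (h₁ : E.M.Parallel a c) (h₂ : E.π.app m a = E.π.app m c)
    (h₁' : E.M.Parallel a' c') (h₂' : E.π.app m a' = E.π.app m c') :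
    E.bracket a c h₁ h₂ = E.bracket a' c' h₁' h₂' := by
  subst ha hc
  rfl

noncomputable def fbracket {m : ℕ} (c₁ c₀ : (graph n G false).cells m)
    (h : (graph n G false).Parallel c₁ c₀) (hπ : (proj n G).app m c₁ = (proj n G).app m c₀) :
    (graph n G false).cells (m + 1) :=
  mk (b := false)
    (fun i => i.E.bracket (ev c₁ i) (ev c₀ i) (parallel_ev i h) (proj_ev i hπ)) (by
    obtain ⟨z, hz, ez⟩ := ev_dfn c₁
    obtain ⟨w, hw, ew⟩ := ev_dfn c₀
    have H : ∀ i : Idx n G, i.E.M.Parallel (eval i z) (eval i w) ∧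
        i.E.π.app _ (eval i z) = i.E.π.app _ (eval i w) := fun i => by
      rw [ez, ew]; exact ⟨parallel_ev i h, proj_ev i hπ⟩
    refine ⟨.bra z w, ⟨hz, hw, H⟩, fun i => ?_⟩
    exact (dif_pos (H i)).trans (bracket_congr i.E (ez i) (ew i) ..))

theorem ev_fbracket (i : Idx n G) {m : ℕ} (c₁ c₀ : (graph n G false).cells m)
    (h : (graph n G false).Parallel c₁ c₀) (hπ : (proj n G).app m c₁ = (proj n G).app m c₀) :
    ev (fbracket c₁ c₀ h hπ) i =
      i.E.bracket (ev c₁ i) (ev c₀ i) (parallel_ev i h) (proj_ev i hπ) :=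
  ev_mk (b := false) _ _ i

variable (n G) in
/-- The free stretching on `G`. -/
noncomputable def stretching : Stretching.{u} n where
  M := graph n G false
  mag := magma n G false
  C := graph n G true
  cmag := magma n G true
  strict := magma_strict n G
  π := proj n G
  π_hom := proj_isMagmaHom
  bracket := fbracket
  t_bracket c₁ c₀ h hπ := ev_ext fun i => (ev_t i _).trans <|
    (congrArg i.E.M.t (ev_fbracket i c₁ c₀ h hπ)).trans (i.E.t_bracket ..)
  s_bracket c₁ c₀ h hπ := ev_ext fun i => (ev_s i _).trans <|
    (congrArg i.E.M.s (ev_fbracket i c₁ c₀ h hπ)).trans (i.E.s_bracket ..)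
  π_bracket c₁ c₀ h hπ := ev_ext fun i => (ev_proj i _).trans <|
    (congrArg (i.E.π.app _) (ev_fbracket i c₁ c₀ h hπ)).trans <|
    (i.E.π_bracket ..).trans <|
    (congrArg i.E.cmag.refl (ev_proj i c₁)).symm.trans
      (ev_refl i ((proj n G).app _ c₁)).symm
  bracket_self c h hπ := ev_ext fun i => (ev_fbracket i c c h hπ).trans <|
    (i.E.bracket_self ..).trans (ev_refl i c).symm

noncomputable def funit {m : ℕ} (g : G.cells m) : (graph n G false).cells m :=
  mk (b := false) (fun i => i.φ.app m g) ⟨.gen g, trivial, fun _ => rfl⟩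

theorem ev_funit (i : Idx n G) {m : ℕ} (g : G.cells m) : ev (funit g) i = i.φ.app m g :=
  ev_mk (b := false) _ _ i

variable (n G) in
noncomputable def unit : G ⟶ (stretching n G).M where
  app _ := funit
  map_s g := ev_ext fun i => (ev_funit i _).trans <| (i.φ.map_s g).trans <|
    (congrArg i.E.M.s (ev_funit i g)).symm.trans (ev_s i (funit g)).symm
  map_t g := ev_ext fun i => (ev_funit i _).trans <| (i.φ.map_t g).trans <|
    (congrArg i.E.M.t (ev_funit i g)).symm.trans (ev_t i (funit g)).symm

theorem ev_unit (i : Idx n G) {m : ℕ} (g : G.cells m) :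
    ev ((unit n G).app m g) i = i.φ.app m g :=
  ev_funit i g

theorem exists_cell {b : Bool} {m : ℕ} (z : Tm n G b m) (hz : Wf z) :
    ∃ w : (graph n G b).cells m, ∀ k, eval k z = ev w k :=
  ⟨mk (fun k => eval k z) ⟨z, hz, fun _ => rfl⟩,
    fun k => (ev_mk (fun k => eval k z) _ k).symm⟩

noncomputable def lift (i : Idx n G) : stretching n G ⟶ i.E :=
  Stretching.Hom.mk (evHom i false) (evHom i true) (evHom_isMagmaHom i false)
    (evHom_isMagmaHom i true)
    (InfGraph.Hom.ext (funext fun _ => funext fun x => (ev_proj i x).symm))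
    (fun c₁ c₀ h hπ => ev_fbracket i c₁ c₀ h hπ)

theorem unit_lift (i : Idx n G) : unit n G ≫ (lift i).m = i.φ :=
  InfGraph.Hom.ext (funext fun _ => funext fun g => ev_funit i g)

/-- The two components of a morphism of stretchings. -/
def hom {E E' : Stretching.{u} n} (f : E ⟶ E') : ∀ b, gr E b ⟶ gr E' b
  | false => f.m
  | true => f.c

theorem hom_isMagmaHom {E E' : Stretching.{u} n} (f : E ⟶ E') :
    ∀ b, IsMagmaHom (ms E b) (ms E' b) (hom f b)
  | false => f.m_hom
  | true => f.c_hom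

/-- The cells of the free stretching, as cells of its two components. -/
def inc : ∀ {b : Bool} {m : ℕ}, Cell n G b m → (gr (stretching n G) b).cells m
  | false, _, x => x
  | true, _, x => x

theorem inc_s {b : Bool} {m : ℕ} (x : (graph n G b).cells (m + 1)) :
    inc ((graph n G b).s x) = (gr (stretching n G) b).s (inc x) := by
  cases b <;> rfl

theorem inc_t {b : Bool} {m : ℕ} (x : (graph n G b).cells (m + 1)) :
    inc ((graph n G b).t x) = (gr (stretching n G) b).t (inc x) := by
  cases b <;> rfl

variable (n G) in
def incHom (b : Bool) : graph n G b ⟶ gr (stretching n G) b where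
  app _ := inc
  map_s := inc_s
  map_t := inc_t

theorem incHom_isMagmaHom (b : Bool) :
    IsMagmaHom (magma n G b) (ms (stretching n G) b) (incHom n G b) := by
  cases b <;> exact .id _

theorem hom_eq (i : Idx n G) (f : stretching n G ⟶ i.E) (hf : unit n G ≫ f.m = i.φ)
    {b : Bool} {m : ℕ} (z : Tm n G b m) (hz : Wf z) (x : Cell n G b m)
    (hx : ∀ k, eval k z = ev x k) :
    (incHom n G b ≫ hom f b).app m x = ev x i := by
  have key : ∀ b, IsMagmaHom (magma n G b) (ms i.E b) (incHom n G b ≫ hom f b) := fun b =>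
    (incHom_isMagmaHom b).comp (hom_isMagmaHom f b)
  induction z with
  | gen g =>
    obtain rfl : x = (unit n G).app _ g := ev_ext fun k => (hx k).symm.trans (ev_unit k g).symm
    exact (congrArg (fun k : G ⟶ i.E.M => k.app _ g) hf).trans (ev_unit i g).symm
  | s z ih =>
    obtain ⟨w, ew⟩ := exists_cell z hz
    obtain rfl : x = (graph n G _).s w := ev_ext fun k =>
      (hx k).symm.trans ((congrArg (gr k.E _).s (ew k)).trans (ev_s k w).symm)
    exact ((incHom n G _ ≫ hom f _).map_s w).trans
      ((congrArg (gr i.E _).s (ih hz w ew)).trans (ev_s i w).symm)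
  | t z ih =>
    obtain ⟨w, ew⟩ := exists_cell z hz
    obtain rfl : x = (graph n G _).t w := ev_ext fun k =>
      (hx k).symm.trans ((congrArg (gr k.E _).t (ew k)).trans (ev_t k w).symm)
    exact ((incHom n G _ ≫ hom f _).map_t w).trans
      ((congrArg (gr i.E _).t (ih hz w ew)).trans (ev_t i w).symm)
  | refl z ih =>
    obtain ⟨w, ew⟩ := exists_cell z hz
    obtain rfl : x = (magma n G _).refl w := ev_ext fun k =>
      (hx k).symm.trans ((congrArg (ms k.E _).refl (ew k)).trans (ev_refl k w).symm)
    exact (preservesReflexors_iff.1 (key _).map_refl w).trans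
      ((congrArg (ms i.E _).refl (ih hz w ew)).trans (ev_refl i w).symm)
  | comp h z z' ih ih' =>
    obtain ⟨hz, hz', H⟩ := hz
    obtain ⟨w, ew⟩ := exists_cell z hz
    obtain ⟨w', ew'⟩ := exists_cell z' hz'
    have e : (graph n G _).Composable h w w' := ev_ext fun k => by
      rw [ev_src, ev_tgt, ← ew, ← ew']
      exact H k
    obtain rfl : x = (magma n G _).comp h w w' e := ev_ext fun k =>
      (hx k).symm.trans ((dif_pos (H k)).trans
        ((comp_congr _ _ (ew k) (ew' k) _ _).trans (ev_comp k h w w' e).symm))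
    exact ((key _).map_comp h w w' e).trans
      ((comp_congr _ _ (ih hz w ew) (ih' hz' w' ew') _ _).trans (ev_comp i h w w' e).symm)
  | rev hn h z ih =>
    obtain ⟨w, ew⟩ := exists_cell z hz
    obtain rfl : x = (magma n G _).rev hn h w := ev_ext fun k =>
      (hx k).symm.trans ((congrArg ((ms k.E _).rev hn h) (ew k)).trans (ev_rev k hn h w).symm)
    exact ((key _).map_rev hn h w).trans
      ((congrArg ((ms i.E _).rev hn h) (ih hz w ew)).trans (ev_rev i hn h w).symm)
  | @bra m z z' ih ih' =>
    obtain ⟨hz, hz', H⟩ := hz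
    obtain ⟨w, ew⟩ := exists_cell z hz
    obtain ⟨w', ew'⟩ := exists_cell z' hz'
    have e : (graph n G false).Parallel w w' := by
      cases m with
      | zero => trivial
      | succ m =>
        refine ⟨ev_ext fun k => ?_, ev_ext fun k => ?_⟩
        · rw [ev_t, ev_t, ← ew, ← ew']
          exact (H k).1.1
        · rw [ev_s, ev_s, ← ew, ← ew']
          exact (H k).1.2
    have eπ : (proj n G).app m w = (proj n G).app m w' := ev_ext fun k => by
      rw [ev_proj, ev_proj, ← ew, ← ew']
      exact (H k).2
    obtain rfl : x = (stretching n G).bracket w w' e eπ := ev_ext fun k =>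
      (hx k).symm.trans ((dif_pos (H k)).trans
        ((bracket_congr _ (ew k) (ew' k) _ _ _ _).trans (ev_fbracket k w w' e eπ).symm))
    exact (f.map_bracket w w' e eπ).trans
      ((bracket_congr _ (ih hz w ew) (ih' hz' w' ew') _ _ _ _).trans
        (ev_fbracket i w w' e eπ).symm)
  | @proj m z ih =>
    obtain ⟨w, ew⟩ := exists_cell z hz
    obtain rfl : x = (proj n G).app m w := ev_ext fun k =>
      (hx k).symm.trans ((congrArg (k.E.π.app m) (ew k)).trans (ev_proj k w).symm)
    exact (congrArg (fun k : (stretching n G).M ⟶ i.E.C => k.app m w) f.comm).symm.trans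
      ((congrArg (i.E.π.app m) (ih hz w ew)).trans (ev_proj i w).symm)

theorem lift_unique (i : Idx n G) (f : stretching n G ⟶ i.E) (hf : unit n G ≫ f.m = i.φ) :
    f = lift i := by
  have H : ∀ (b : Bool) (m : ℕ) (x : Cell n G b m),
      (incHom n G b ≫ hom f b).app m x = ev x i := fun b m x => by
    obtain ⟨z, hz, e⟩ := ev_dfn x
    exact hom_eq i f hf z hz x e
  apply Stretching.Hom.ext
  · exact InfGraph.Hom.ext (funext fun m => funext fun x => H false m x)
  · exact InfGraph.Hom.ext (funext fun m => funext fun x => H true m x)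

end Free

instance stretchForget_isRightAdjoint (n : ℕ) : (stretchForget.{u} n).IsRightAdjoint := by
  have : ∀ G : InfGraph.{u}, Limits.HasInitial (StructuredArrow G (stretchForget.{u} n)) := by
    intro G
    refine Limits.IsInitial.hasInitial (X := StructuredArrow.mk
      (T := stretchForget.{u} n) (Y := Free.stretching n G) (Free.unit n G)) ?_
    refine Limits.IsInitial.ofUniqueHom
      (fun A => StructuredArrow.homMk (Free.lift ⟨A.right, A.hom⟩)
        (Free.unit_lift ⟨A.right, A.hom⟩)) fun A f => ?_
    apply StructuredArrow.ext
    exact Free.lift_unique ⟨A.right, A.hom⟩ f.right (StructuredArrow.w f)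
  exact isRightAdjointOfStructuredArrowInitials _

/-! ## Weak `(∞,n)`-categories -/

/-- The free `(∞,n)`-categorical stretching functor, left adjoint to the forgetful functor. -/
noncomputable def freeStretching (n : ℕ) : InfGraph.{u} ⥤ Stretching.{u} n :=
  (stretchForget n).leftAdjoint

/-- The monad `𝕋^(∞,n) = (T, μ, λ)` on `∞`-graphs generated by the adjunction between free
stretching and forgetful functor. -/
noncomputable def weakMonad (n : ℕ) : Monad InfGraph.{u} :=
  (Adjunction.ofIsRightAdjoint (stretchForget.{u} n)).toMonad

/-- Weak `(∞,n)`-categories: algebras for `𝕋^(∞,n)`. -/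
abbrev WeakInfCat (n : ℕ) : Type (u + 1) := (weakMonad.{u} n).Algebra

/-- The `(∞,n)`-magma `M(G)` of the free stretching on `G`, whose underlying `∞`-graph is `T G`. -/
noncomputable def freeMagma (n : ℕ) (G : InfGraph.{u}) : MagmaStr n ((weakMonad n).obj G) :=
  ((freeStretching n).obj G).mag

/-- The universal map `λ_G : G ⟶ T G`. -/
noncomputable def lam (n : ℕ) (G : InfGraph.{u}) : G ⟶ (weakMonad n).obj G :=
  (weakMonad n).η.app G

end WeakCat

namespace WeakCat

theorem MagmaStr.comp_congr_args (S : MagmaStr n X) {p m : ℕ} (h : p < m) {y y' x x' : X.cells m}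
    (hy : y = y') (hx : x = x') (e : X.Composable h y x) (e' : X.Composable h y' x') :
    S.comp h y x e = S.comp h y' x' e' := by
  subst hy hx
  rfl

variable (n)

/-- The functor `T` sends morphisms of `∞`-graphs to morphisms of `(∞,n)`-magmas. -/
theorem isMagmaHom_map (f : X ⟶ Y) :
    IsMagmaHom (freeMagma n X) (freeMagma n Y) ((weakMonad n).map f) :=
  ((freeStretching n).map f).m_hom

/-- The multiplication `μ_G` is a morphism of `(∞,n)`-magmas. -/
theorem isMagmaHom_mu (G : InfGraph.{u}) :
    IsMagmaHom (freeMagma n ((weakMonad n).obj G)) (freeMagma n G) ((weakMonad n).μ.app G) :=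
  ((Adjunction.ofIsRightAdjoint (stretchForget.{u} n)).counit.app
    ((freeStretching n).obj G)).m_hom

theorem mu_lam (G : InfGraph.{u}) {m : ℕ} (x : ((weakMonad n).obj G).cells m) :
    ((weakMonad n).μ.app G).app m ((lam n ((weakMonad n).obj G)).app m x) = x :=
  congrArg (fun k : (weakMonad n).obj G ⟶ (weakMonad n).obj G => k.app m x)
    ((weakMonad n).left_unit G)

theorem map_lam (f : X ⟶ Y) {m : ℕ} (x : X.cells m) :
    ((weakMonad n).map f).app m ((lam n X).app m x) = (lam n Y).app m (f.app m x) :=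
  (congrArg (fun k : X ⟶ (weakMonad n).obj Y => k.app m x) ((weakMonad n).η.naturality f)).symm

variable {n}

namespace WeakInfCat

variable (A : WeakInfCat.{u} n)

theorem a_lam {m : ℕ} (x : A.A.cells m) : A.a.app m ((lam n A.A).app m x) = x :=
  congrArg (fun k : A.A ⟶ A.A => k.app m x) A.unit

theorem a_mu {m : ℕ} (x : ((weakMonad n).obj ((weakMonad n).obj A.A)).cells m) :
    A.a.app m (((weakMonad n).μ.app A.A).app m x) =
      A.a.app m (((weakMonad n).map A.a).app m x) :=
  congrArg (fun k : (weakMonad n).obj ((weakMonad n).obj A.A) ⟶ A.A => k.app m x) A.assoc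

theorem a_map {A B : WeakInfCat.{u} n} (f : A ⟶ B) {m : ℕ}
    (x : ((weakMonad n).obj A.A).cells m) :
    B.a.app m (((weakMonad n).map f.f).app m x) = f.f.app m (A.a.app m x) :=
  congrArg (fun k : (weakMonad n).obj A.A ⟶ B.A => k.app m x) f.h

/-- The `(∞,n)`-magma structure of a weak `(∞,n)`-category: an operation is applied to generators
of the free `(∞,n)`-magma and the result is evaluated by the algebra structure. -/
noncomputable def magma : MagmaStr n A.A where
  refl x := A.a.app _ ((freeMagma n A.A).refl ((lam n A.A).app _ x))
  s_refl x := by rw [← A.a.map_s, (freeMagma n A.A).s_refl, a_lam]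
  t_refl x := by rw [← A.a.map_t, (freeMagma n A.A).t_refl, a_lam]
  comp h y x e := A.a.app _ ((freeMagma n A.A).comp h ((lam n A.A).app _ y)
    ((lam n A.A).app _ x) (e.map (lam n A.A)))
  src_comp hp hq y x e e' := by
    have e₁ := e'.map (lam n A.A)
    have e₂ := e₁
    rw [InfGraph.Hom.map_src, InfGraph.Hom.map_src] at e₂
    rw [← InfGraph.Hom.map_src, (freeMagma n A.A).src_comp hp hq _ _ _ e₂]
    exact congrArg _ (MagmaStr.comp_congr_args _ _ (InfGraph.Hom.map_src _ _ _).symm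
      (InfGraph.Hom.map_src _ _ _).symm _ _)
  tgt_comp hp hq y x e e' := by
    have e₁ := e'.map (lam n A.A)
    have e₂ := e₁
    rw [InfGraph.Hom.map_tgt, InfGraph.Hom.map_tgt] at e₂
    rw [← InfGraph.Hom.map_tgt, (freeMagma n A.A).tgt_comp hp hq _ _ _ e₂]
    exact congrArg _ (MagmaStr.comp_congr_args _ _ (InfGraph.Hom.map_tgt _ _ _).symm
      (InfGraph.Hom.map_tgt _ _ _).symm _ _)
  src_comp_of_le hq h y x e := by
    rw [← InfGraph.Hom.map_src, (freeMagma n A.A).src_comp_of_le hq, InfGraph.Hom.map_src, a_lam]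
  tgt_comp_of_le hq h y x e := by
    rw [← InfGraph.Hom.map_tgt, (freeMagma n A.A).tgt_comp_of_le hq, InfGraph.Hom.map_tgt, a_lam]
  rev hn h x := A.a.app _ ((freeMagma n A.A).rev hn h ((lam n A.A).app _ x))
  s_rev hn h h' x := by rw [← A.a.map_s, (freeMagma n A.A).s_rev hn h, (lam n A.A).map_s]
  t_rev hn h h' x := by rw [← A.a.map_t, (freeMagma n A.A).t_rev hn h, (lam n A.A).map_t]
  s_rev_self hn x := by
    rw [← A.a.map_s, (freeMagma n A.A).s_rev_self, ← (lam n A.A).map_t, a_lam]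
  t_rev_self hn x := by
    rw [← A.a.map_t, (freeMagma n A.A).t_rev_self, ← (lam n A.A).map_s, a_lam]

/-- The algebra structure is a morphism of `(∞,n)`-magmas. -/
theorem isMagmaHom_a : IsMagmaHom (freeMagma n A.A) A.magma A.a where
  map_refl := by
    refine preservesReflexors_iff.2 fun {m} x => ?_
    have h := preservesReflexors_iff.1 (isMagmaHom_mu n A.A).map_refl
      ((lam n ((weakMonad n).obj A.A)).app m x)
    have h' := preservesReflexors_iff.1 (isMagmaHom_map n A.a).map_refl
      ((lam n ((weakMonad n).obj A.A)).app m x)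
    rw [mu_lam] at h
    rw [map_lam] at h'
    exact (congrArg _ h.symm).trans ((A.a_mu _).trans (congrArg _ h'))
  map_comp {p m} hpm y x e := by
    have h := (isMagmaHom_mu n A.A).map_comp hpm _ _ (e.map (lam n ((weakMonad n).obj A.A)))
    have h' := (isMagmaHom_map n A.a).map_comp hpm _ _ (e.map (lam n ((weakMonad n).obj A.A)))
    refine (congrArg (A.a.app m) (h.trans (MagmaStr.comp_congr_args _ _ (mu_lam n _ _)
      (mu_lam n _ _) _ e)).symm).trans ((A.a_mu _).trans (congrArg (A.a.app m) (h'.trans ?_)))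
    exact MagmaStr.comp_congr_args _ _ (map_lam n _ _) (map_lam n _ _) _ _
  map_rev {p m} hn hpm x := by
    have h := (isMagmaHom_mu n A.A).map_rev hn hpm ((lam n ((weakMonad n).obj A.A)).app m x)
    have h' := (isMagmaHom_map n A.a).map_rev hn hpm ((lam n ((weakMonad n).obj A.A)).app m x)
    rw [mu_lam] at h
    rw [map_lam] at h'
    exact (congrArg _ h.symm).trans ((A.a_mu _).trans (congrArg _ h'))

theorem magma_reflTo {p m : ℕ} (h : p < m) (x : A.A.cells p) :
    A.magma.reflTo h.le x =
      A.a.app m ((freeMagma n A.A).reflTo h.le ((lam n A.A).app p x)) := by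
  rw [A.isMagmaHom_a.map_reflTo h, a_lam]

variable (n) in
/-- On a free algebra, the magma structure is that of the free stretching. -/
theorem magma_free (G : InfGraph.{u}) :
    magma ((weakMonad n).free.obj G) = freeMagma n G := by
  apply MagmaStr.ext
  · funext m x
    have h := preservesReflexors_iff.1 (isMagmaHom_mu n G).map_refl
      ((lam n ((weakMonad n).obj G)).app m x)
    exact h.trans (congrArg _ (mu_lam n G x))
  · funext p m hpm y x e
    have h := (isMagmaHom_mu n G).map_comp hpm _ _ (e.map (lam n ((weakMonad n).obj G)))
    exact h.trans (MagmaStr.comp_congr_args _ _ (mu_lam n _ _) (mu_lam n _ _) _ e)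
  · funext p m hn hpm x
    have h := (isMagmaHom_mu n G).map_rev hn hpm ((lam n ((weakMonad n).obj G)).app m x)
    exact h.trans (congrArg _ (mu_lam n G x))

theorem preservesReflexors_hom {A B : WeakInfCat.{u} n} (f : A ⟶ B) :
    PreservesReflexors A.magma B.magma f.f := by
  refine preservesReflexors_iff.2 fun {m} x => ?_
  have h := preservesReflexors_iff.1 (isMagmaHom_map n f.f).map_refl ((lam n A.A).app m x)
  rw [map_lam] at h
  exact (a_map f _).symm.trans (congrArg _ h)

theorem preservesReversors_hom {A B : WeakInfCat.{u} n} (f : A ⟶ B) :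
    PreservesReversors A.magma B.magma f.f := by
  intro p m hn hpm x
  have h := (isMagmaHom_map n f.f).map_rev hn hpm ((lam n A.A).app m x)
  rw [map_lam] at h
  exact (a_map f _).symm.trans (congrArg _ h)

end WeakInfCat

end WeakCat

theorem mainTheorem4 (n : ℕ) :
    ∃ 𝓜 : ∀ A : WeakCat.WeakInfCat.{u} n, WeakCat.MagmaStr n A.A,
      (∀ A : WeakCat.WeakInfCat.{u} n,
        (∀ {p m : ℕ} (h : p < m) (a b : A.A.cells m) (e : A.A.Composable h a b),
          (𝓜 A).comp h a b e = A.a.app m ((WeakCat.freeMagma n A.A).comp h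
            ((WeakCat.lam n A.A).app m a) ((WeakCat.lam n A.A).app m b)
            (e.map (WeakCat.lam n A.A)))) ∧
        (∀ {p m : ℕ} (h : p < m) (a : A.A.cells p),
          (𝓜 A).reflTo h.le a = A.a.app m ((WeakCat.freeMagma n A.A).reflTo h.le
            ((WeakCat.lam n A.A).app p a))) ∧
        (∀ {p m : ℕ} (hn : n ≤ p) (h : p < m) (a : A.A.cells m),
          (𝓜 A).rev hn h a = A.a.app m ((WeakCat.freeMagma n A.A).rev hn h
            ((WeakCat.lam n A.A).app m a))) ∧
        WeakCat.IsMagmaHom (WeakCat.freeMagma n A.A) (𝓜 A) A.a) ∧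
      (∀ G : WeakCat.InfGraph.{u},
        𝓜 ((WeakCat.weakMonad n).free.obj G) = WeakCat.freeMagma n G) ∧
      (∀ (A B : WeakCat.WeakInfCat.{u} n) (f : A ⟶ B),
        WeakCat.PreservesReflexors (𝓜 A) (𝓜 B) f.f ∧
        WeakCat.PreservesReversors (𝓜 A) (𝓜 B) f.f) :=
  ⟨fun A => WeakCat.WeakInfCat.magma A,
    fun A => ⟨fun _ _ _ _ => rfl, fun h a => WeakCat.WeakInfCat.magma_reflTo A h a,
      fun _ _ _ => rfl, WeakCat.WeakInfCat.isMagmaHom_a A⟩,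
    fun G => WeakCat.WeakInfCat.magma_free n G,
    fun _ _ f => ⟨WeakCat.WeakInfCat.preservesReflexors_hom f,
      WeakCat.WeakInfCat.preservesReversors_hom f⟩⟩
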